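/- Theorem ($k$-hop indistinguishability of nodes in $C_0$ and $C_1$). All graphs are finite and simple. Definitions. Let $k\ge 1$ and $\beta\ge 2(k+1)$ be integers. The cluster tree skeletons $CT_1,CT_2,\dots$ are trees, whose vertices are called clusters, rooted at the cluster $C_0$. An edge between clusters $C$ and $C'$ carries a label $\{(C,x),(C',y)\}$; $x$ is called the outgoing label of this edge at $C$, and $y$ its outgoing label at $C'$. They are defined inductively: - $CT_1$ has the four clusters $C_0,C_1,C_2,C_3$ and the three edges $\{(C_0,\beta^0),(C_1,\beta^1)\}$, $\{(C_0,\beta^1),(C_2,\beta^2)\}$, $\{(C_1,\beta^0),(C_3,\beta^1)\}$. - For $j\ge 2$, $CT_j$ is obtained from $CT_{j-1}$ by attaching new clusters. (1) To each internal (non-leaf) cluster $C$ of $CT_{j-1}$ attach one new cluster $C'$ via an edge $\{(C,\beta^{j}),(C',\beta^{j+1})\}$. (2) To each leaf cluster $C$ of $CT_{j-1}$, whose edge to its parent has outgoing label $\beta^q$ at $C$, attach, for each $p\in\{0,\dots,j\}\setminus\{q\}$, one new cluster $C'$ via an edge $\{(C,\beta^p),(C',\beta^{p+1})\}$. A CT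 graph $G_k$ (with parameter $\beta$) is a graph whose node set is partitioned into independent sets, one for each cluster of $CT_k$ (and denoted like the cluster), such that for each edge of $CT_k$ with label $\{(C,x),(C',y)\}$ every node in $C$ has exactly $x$ neighbors in $C'$ and every node in $C'$ has exactly $y$ neighbors in $C$, and such that there are no edges between clusters that are not adjacent in $CT_k$. For a node $v$ of a graph $G$, the $k$-hop subgraph $G^k(v)$ is the subgraph of $G$ induced by the nodes at distance at most $k$ from $v$, with all edges between two nodes at distance exactly $k$ from $v$ removed. Nodes $v$ and $w$ of $G$ are $k$-hop indistinguishable if there is a graph isomorphism $\phi$ from $G^k(v)$ to $G^k(w)$ with $\phi(v)=w$. Statement. Let $k\ge 1$ and $\beta\ge 2(k+1)$, and let $G_k$ be a CT graph with parameter $\beta$ whose girth (the length of a shortest cycle, $\infty$ if there is none) is at least $2k+1$. Then any $v_0\in C_0$ and any $v_1\in C_1$ are $k$-hop indistinguishable in $G_k$. -/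

import Mathlib

/-! ### Cluster tree skeletons -/

/-- A name for a cluster of a skeleton, given by the path that leads to it from the root.  The root
cluster is `[]`, and the cluster attached to `C` along an edge whose label at `C` is `β ^ p` is named
`p :: C`. -/
abbrev Cluster := List ℕ

/-- A labelled graph on clusters.  The unordered pair `s((C, x), (D, y))` is an edge between `C` and
`D` with label `{(C, β ^ x), (D, β ^ y)}`; only the exponents of the labels are stored. -/
structure Skeleton where
  clusters : Set Cluster
  edges : Set (Sym2 (Cluster × ℕ))

namespace Skeleton

/-- `C` has an incident edge whose outgoing label at `C` is `β ^ x`. -/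
def HasOutLabel (S : Skeleton) (C : Cluster) (x : ℕ) : Prop :=
  ∃ e ∈ S.edges, (C, x) ∈ e

/-- A leaf cluster: exactly one edge of the skeleton is incident to it. -/
def IsLeaf (S : Skeleton) (C : Cluster) : Prop :=
  C ∈ S.clusters ∧ ∃! e : Sym2 (Cluster × ℕ), e ∈ S.edges ∧ ∃ x, (C, x) ∈ e

/-- An internal cluster is a cluster that is not a leaf. -/
def IsInternal (S : Skeleton) (C : Cluster) : Prop :=
  C ∈ S.clusters ∧ ¬ S.IsLeaf C

/-- In the growth step from `S = CT_{k-1}` to `CT_k`, a new cluster `p :: C` is attached to `C` via an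
edge labelled `{(C, β ^ p), (p :: C, β ^ (p + 1))}`.  An internal cluster gets one new neighbour,
with `p = k`; a leaf with outgoing label `β ^ q` on its only edge (the edge to its parent) gets one
new neighbour for each `p ∈ {0, …, k}` with `p ≠ q`. -/
def Attaches (S : Skeleton) (k : ℕ) (C : Cluster) (p : ℕ) : Prop :=
  (S.IsInternal C ∧ p = k) ∨
    (S.IsLeaf C ∧ ∃ q, S.HasOutLabel C q ∧ p ≤ k ∧ p ≠ q)

/-- One growth step, from `S = CT_{k-1}` to `CT_k`. -/
def grow (S : Skeleton) (k : ℕ) : Skeleton where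
  clusters := S.clusters ∪ {D | ∃ C p, S.Attaches k C p ∧ D = p :: C}
  edges := S.edges ∪ {e | ∃ C p, S.Attaches k C p ∧ e = s((C, p), (p :: C, p + 1))}

end Skeleton

/-- The root cluster `C₀`. -/
def clusterC0 : Cluster := []

/-- The cluster `C₁`, adjacent to `C₀` via the edge `{(C₀, β ^ 0), (C₁, β ^ 1)}`. -/
def clusterC1 : Cluster := [0]

/-- The cluster `C₂`, adjacent to `C₀` via the edge `{(C₀, β ^ 1), (C₂, β ^ 2)}`. -/
def clusterC2 : Cluster := [1]

/-- The cluster `C₃`, adjacent to `C₁` via the edge `{(C₁, β ^ 0), (C₃, β ^ 1)}`. -/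
def clusterC3 : Cluster := [0, 0]

/-- The base case `CT_1`. -/
def ctBase : Skeleton where
  clusters := {clusterC0, clusterC1, clusterC2, clusterC3}
  edges := {s((clusterC0, 0), (clusterC1, 1)), s((clusterC0, 1), (clusterC2, 2)),
    s((clusterC1, 0), (clusterC3, 1))}

/-- The cluster tree skeleton `CT_k`, for `k ≥ 1`.  (The value at `k = 0` is a dummy.) -/
def ctSkeleton : ℕ → Skeleton
  | 0 => ctBase
  | 1 => ctBase
  | k + 2 => (ctSkeleton (k + 1)).grow (k + 2)

/-! ### Cluster tree graphs -/

/-- `G` is a CT graph for the skeleton `CT_k` with parameter `β`, where `cl v` is the cluster of the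
node `v`. -/
structure IsCTGraph {V : Type*} (k β : ℕ) (G : SimpleGraph V) (cl : V → Cluster) : Prop where
  /-- Every node belongs to a cluster of the skeleton. -/
  mem_clusters : ∀ v, cl v ∈ (ctSkeleton k).clusters
  /-- Every cluster is an independent set. -/
  independent : ∀ v w, cl v = cl w → ¬ G.Adj v w
  /-- Edges of `G` run only between clusters that are adjacent in the skeleton. -/
  edge_of_adj : ∀ v w, G.Adj v w → ∃ x y, s((cl v, x), (cl w, y)) ∈ (ctSkeleton k).edges
  /-- If `C` and `D` are adjacent in the skeleton and `C` has outgoing label `β ^ x` towards `D`, then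
  each node in `C` has `β ^ x` neighbours in `D`.  (The pair is unordered, so this applies to both
  ends of the edge.) -/
  biregular : ∀ C D x y, s((C, x), (D, y)) ∈ (ctSkeleton k).edges →
    ∀ v, cl v = C → {w | G.Adj v w ∧ cl w = D}.ncard = β ^ x

/-! ### Indistinguishability -/

/-- The `k`-hop subgraph `G^k(v)`: the subgraph induced by the nodes at distance at most `k` from `v`,
without the edges between two nodes at distance exactly `k`. -/
def kHopSubgraph {V : Type*} (G : SimpleGraph V) (k : ℕ) (v : V) : G.Subgraph where
  verts := {w | G.edist v w ≤ k}
  Adj a b := G.Adj a b ∧ G.edist v a ≤ k ∧ G.edist v b ≤ k ∧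
    ¬ (G.edist v a = k ∧ G.edist v b = k)
  adj_sub h := h.1
  edge_vert h := h.2.1
  symm := ⟨fun _ _ h => ⟨h.1.symm, h.2.2.1, h.2.1, fun h' => h.2.2.2 h'.symm⟩⟩

theorem self_mem_kHopSubgraph {V : Type*} (G : SimpleGraph V) (k : ℕ) (v : V) :
    v ∈ (kHopSubgraph G k v).verts := by
  simp [kHopSubgraph]

/-- `v` and `w` are `k`-hop indistinguishable in `G`: there is a graph isomorphism from `G^k(v)` to
`G^k(w)` that maps `v` to `w`. -/
def KHopIndistinguishable {V : Type*} (G : SimpleGraph V) (k : ℕ) (v w : V) : Prop :=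
  ∃ φ : (kHopSubgraph G k v).coe ≃g (kHopSubgraph G k w).coe,
    φ ⟨v, self_mem_kHopSubgraph G k v⟩ = ⟨w, self_mem_kHopSubgraph G k w⟩

/-!
Because of the girth, the `k`-hop subgraph of a node is the tree of shortest walks of length at most
`k` from it: below distance `k`, each node has one parent, and all its other neighbours are children
(`not_adj_of_mem_sphere`, `eq_of_adj_of_mem_sphere_succ`, `kHopSubgraph_adj_iff`). It remains to match
the trees of `v₀` and `v₁` level by level.

The skeleton is regular in the following sense. With `stage C` the growth step that creates the
cluster `C`, where `C₀` and `C₁` both count as created at step `0`, the clusters of `CT_k` of stage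
less than `k` have exactly the outgoing labels `β ^ 0, …, β ^ k`, one each, and those of stage `k` are
leaves with a single edge, to the parent (`ctSkeleton_eq_closedSkeleton`, `isCluster_nbr_iff_of_lt`,
`isCluster_nbr_iff_of_eq`).

Suppose that a node `u` at depth `d < k` is matched to `u'`. If their clusters have the same outgoing
labels, their neighbours can be matched label by label. The parents of `u` and `u'` may lie along
different labels `β ^ a` and `β ^ b`; then `u` has one child too few along `β ^ a` and `u'` has one too
few along `β ^ b`, so one child of `u` along `β ^ b` has to be matched to a child of `u'` along
`β ^ a`. The invariant `Compatible d` survives both kinds of steps (`SimilarClusters.compatible_nbr`,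
`Compatible.nbr_swap`): either both clusters have stage at most `d` and the entry labels are at most
`d + 1`, or the entry labels agree and the clusters are obtained by the same steps from clusters of
stage at most `d`, with equal stages along the way. In particular the two clusters have the same
outgoing labels as long as `d < k` (`SimilarClusters.isCluster_nbr_iff`), and the matching reaches
depth `k`.
-/

/-! ### The closed form of the skeletons -/

/-- The growth step at which a cluster is created, where `C₀ = []` and `C₁ = [0]` count as created
at step `0`. The clusters of `CT_1` thus arise from these two by a growth step like all others, and a
child `p :: C` other than `C₁` is created at step `max (stage C + 1) p`: it is attached while `C` is
a leaf if `p ≤ stage C + 1`, and to the internal cluster `C` at step `p` otherwise. For a child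
`[p]` of `C₀` this step is `p`. -/
def stage : Cluster → ℕ
  | [] => 0
  | [p] => p
  | p :: q :: C => max (stage (q :: C) + 1) p

/-- The names of the clusters of `CT_k`: no child is attached along the label that already leads to
the parent, and the cluster has been created by step `k`. -/
def IsCluster (k : ℕ) (C : Cluster) : Prop :=
  List.IsChain (fun p q => p ≠ q + 1) C ∧ stage C ≤ k

/-- The neighbour of a cluster along its outgoing label `β ^ x`. -/
def nbr : Cluster → ℕ → Cluster
  | [], x => [x]
  | p :: C, x => if x = p + 1 then C else x :: p :: C

/-- The exponent of the outgoing label at `C` of the edge to an adjacent cluster `D`. The value is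
meaningless if neither of `C` and `D` is the parent of the other. -/
def outLabel (C D : Cluster) : ℕ :=
  if D.length < C.length then C.headI + 1 else D.headI

theorem stage_cons_le (p : ℕ) (C : Cluster) : stage (p :: C) ≤ max (stage C + 1) p := by
  cases C <;> simp [stage]

theorem le_stage_cons (p : ℕ) (C : Cluster) : p ≤ stage (p :: C) := by
  cases C <;> simp [stage]

theorem stage_tail_le (p : ℕ) (C : Cluster) : stage C ≤ stage (p :: C) := by
  rcases C with _ | ⟨q, C⟩
  · simp [stage]
  · simp only [stage]
    omega

theorem outLabel_nbr (C : Cluster) (x : ℕ) : outLabel C (nbr C x) = x := by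
  rcases C with _ | ⟨p, C⟩
  · simp [nbr, outLabel]
  · by_cases h : x = p + 1 <;> simp [nbr, outLabel, h]

theorem outLabel_cons_self (p : ℕ) (C : Cluster) : outLabel (p :: C) C = p + 1 := by
  simp [outLabel]

theorem outLabel_self_cons (p : ℕ) (C : Cluster) : outLabel C (p :: C) = p := by
  simp [outLabel]

theorem outLabel_nbr_self_le (C : Cluster) (x : ℕ) : outLabel (nbr C x) C ≤ x + 1 := by
  rcases C with _ | ⟨p, C⟩
  · simp [nbr, outLabel]
  · by_cases h : x = p + 1
    · simp [nbr, h, outLabel]; omega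
    · simp [nbr, outLabel, h]

theorem stage_nbr_le (C : Cluster) (x : ℕ) : stage (nbr C x) ≤ max (stage C + 1) x := by
  rcases C with _ | ⟨p, C⟩
  · simp [nbr, stage]
  · by_cases h : x = p + 1
    · have := stage_tail_le p C
      simp [nbr, h]; omega
    · simpa [nbr, h] using stage_cons_le x (p :: C)

theorem IsCluster.tail {k p : ℕ} {C : Cluster} (h : IsCluster k (p :: C)) : IsCluster k C :=
  ⟨h.1.tail, (stage_tail_le p C).trans h.2⟩

theorem IsCluster.nbr_eq_cons {k p : ℕ} {C : Cluster} (h : IsCluster k (p :: C)) :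
    nbr C p = p :: C := by
  rcases C with _ | ⟨q, C⟩
  · rfl
  · have := h.1
    simp at this
    simp [nbr, this.1]

theorem nbr_cons_succ (p : ℕ) (C : Cluster) : nbr (p :: C) (p + 1) = C := by
  simp [nbr]

/-- A cluster that is not of the last generation has all outgoing labels `β ^ 0, …, β ^ k`. -/
theorem isCluster_nbr_iff_of_lt {k : ℕ} {C : Cluster} (hC : IsCluster k C) (h : stage C < k)
    (x : ℕ) : IsCluster k (nbr C x) ↔ x ≤ k := by
  rcases C with _ | ⟨p, C⟩
  · simp [nbr, IsCluster, stage]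
  · by_cases hx : x = p + 1
    · have := le_stage_cons p C
      simp only [nbr, hx, if_true, hC.tail, true_iff]
      omega
    · have h1 := stage_cons_le x (p :: C)
      have h2 := le_stage_cons x (p :: C)
      have h3 := hC.1
      simp only [nbr, hx, if_false, IsCluster, List.isChain_cons_cons, ne_eq, not_false_eq_true,
        h3, true_and, and_self]
      omega

/-- A cluster of the last generation is adjacent to its parent only. -/
theorem isCluster_nbr_iff_of_eq {k p : ℕ} {C : Cluster} (hC : IsCluster k (p :: C))
    (h : stage (p :: C) = k) (x : ℕ) : IsCluster k (nbr (p :: C) x) ↔ x = p + 1 := by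
  by_cases hx : x = p + 1
  · simp [nbr, hx, hC.tail]
  · simp [nbr, hx, IsCluster, stage, h]

/-- The closed form of the skeleton `CT_k`. -/
def closedSkeleton (k : ℕ) : Skeleton where
  clusters := {C | IsCluster k C}
  edges := {e | ∃ C p, IsCluster k (p :: C) ∧ e = s((C, p), (p :: C, p + 1))}

theorem mem_edges_closedSkeleton {k : ℕ} {C D : Cluster} {x y : ℕ} :
    s((C, x), (D, y)) ∈ (closedSkeleton k).edges ↔
      IsCluster k C ∧ IsCluster k D ∧ D = nbr C x ∧ y = outLabel D C := by
  constructor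
  · rintro ⟨E, p, hE, h⟩
    rw [Sym2.eq_iff] at h
    rcases h with ⟨h1, h2⟩ | ⟨h1, h2⟩ <;> cases h1 <;> cases h2
    · exact ⟨hE.tail, hE, hE.nbr_eq_cons.symm, (outLabel_cons_self _ _).symm⟩
    · exact ⟨hE, hE.tail, (nbr_cons_succ _ _).symm, (outLabel_self_cons _ _).symm⟩
  · rintro ⟨hC, hD, rfl, rfl⟩
    rcases C with _ | ⟨p, C⟩
    · exact ⟨[], x, hD, by simp [nbr, outLabel]⟩
    · by_cases hx : x = p + 1
      · subst hx
        exact ⟨C, p, hC, by rw [nbr_cons_succ, outLabel_self_cons, Sym2.eq_swap]⟩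
      · have h : nbr (p :: C) x = x :: p :: C := by simp [nbr, hx]
        rw [h] at hD ⊢
        exact ⟨_, x, hD, by rw [outLabel_cons_self]⟩

theorem exists_mem_edges_closedSkeleton {k : ℕ} {C : Cluster} {x : ℕ} {e : Sym2 (Cluster × ℕ)} :
    (e ∈ (closedSkeleton k).edges ∧ (C, x) ∈ e) ↔
      IsCluster k C ∧ IsCluster k (nbr C x) ∧ e = s((C, x), (nbr C x, outLabel (nbr C x) C)) := by
  constructor
  · rintro ⟨he, hx⟩
    obtain ⟨⟨D, y⟩, rfl⟩ := hx
    obtain ⟨hC, hD, rfl, rfl⟩ := mem_edges_closedSkeleton.1 he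
    exact ⟨hC, hD, rfl⟩
  · rintro ⟨hC, hD, rfl⟩
    exact ⟨mem_edges_closedSkeleton.2 ⟨hC, hD, rfl, rfl⟩, Sym2.mem_mk_left _ _⟩

theorem hasOutLabel_closedSkeleton {k : ℕ} {C : Cluster} {x : ℕ} :
    (closedSkeleton k).HasOutLabel C x ↔ IsCluster k C ∧ IsCluster k (nbr C x) := by
  simp [Skeleton.HasOutLabel, exists_mem_edges_closedSkeleton]

/-- The leaves of `CT_k` are the clusters created at the last growth step. -/
theorem isLeaf_closedSkeleton {k : ℕ} (hk : 1 ≤ k) {C : Cluster} :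
    (closedSkeleton k).IsLeaf C ↔ IsCluster k C ∧ stage C = k := by
  have key : (closedSkeleton k).IsLeaf C ↔ IsCluster k C ∧ ∃! x, IsCluster k (nbr C x) := by
    refine and_congr_right fun hC => ?_
    change IsCluster k C at hC
    have : ∀ e, (e ∈ (closedSkeleton k).edges ∧ ∃ x, (C, x) ∈ e) ↔ ∃ x, IsCluster k (nbr C x) ∧
        e = s((C, x), (nbr C x, outLabel (nbr C x) C)) := by
      intro e
      rw [← exists_and_left]
      simp [exists_mem_edges_closedSkeleton, hC]
    simp only [this]
    constructor
    · rintro ⟨e, ⟨x, hx, rfl⟩, hu⟩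
      refine ⟨x, hx, fun y hy => ?_⟩
      have h := hu _ ⟨y, hy, rfl⟩
      rw [Sym2.eq_iff] at h
      rcases h with ⟨h, -⟩ | ⟨h, -⟩
      · exact (Prod.ext_iff.1 h).2
      · have h1 := (Prod.ext_iff.1 h).1
        have h2 := congrArg List.length h1
        exfalso
        rcases C with _ | ⟨p, C⟩
        · simp [nbr] at h2
        · by_cases hp : x = p + 1 <;> simp [nbr, hp] at h2
    · rintro ⟨x, hx, hu⟩
      refine ⟨_, ⟨x, hx, rfl⟩, ?_⟩
      rintro e ⟨y, hy, rfl⟩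
      rw [hu y hy]
  rw [key]
  refine and_congr_right fun hC => ?_
  constructor
  · rintro ⟨x, -, hu⟩
    by_contra h
    have hl : stage C < k := lt_of_le_of_ne hC.2 h
    have h0 := hu 0 ((isCluster_nbr_iff_of_lt hC hl 0).2 (by omega))
    have h1 := hu 1 ((isCluster_nbr_iff_of_lt hC hl 1).2 hk)
    omega
  · intro h
    rcases C with _ | ⟨p, C⟩
    · simp [stage] at h; omega
    · refine ⟨p + 1, (isCluster_nbr_iff_of_eq hC h _).2 rfl, fun y hy => ?_⟩
      exact (isCluster_nbr_iff_of_eq hC h _).1 hy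

theorem attaches_closedSkeleton {k : ℕ} (hk : 1 ≤ k) {C : Cluster} {p : ℕ} :
    (closedSkeleton k).Attaches (k + 1) C p ↔
      IsCluster (k + 1) (p :: C) ∧ stage (p :: C) = k + 1 := by
  have hint : (closedSkeleton k).IsInternal C ↔ IsCluster k C ∧ stage C < k := by
    rw [Skeleton.IsInternal, isLeaf_closedSkeleton hk]
    constructor
    · rintro ⟨h1, h2⟩
      exact ⟨h1, lt_of_le_of_ne h1.2 fun h => h2 ⟨h1, h⟩⟩
    · rintro ⟨h1, h2⟩
      exact ⟨h1, fun h => h2.ne h.2⟩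
  rw [Skeleton.Attaches, hint, isLeaf_closedSkeleton hk]
  simp only [hasOutLabel_closedSkeleton]
  rcases C with _ | ⟨q, C⟩
  · have h0 : stage [] = 0 := rfl
    simp only [IsCluster, stage, List.isChain_nil, List.isChain_singleton, true_and]
    constructor
    · rintro (h | ⟨h, -⟩)
      · omega
      · omega
    · intro h
      left
      omega
  · have h1 : stage (p :: q :: C) = max (stage (q :: C) + 1) p := rfl
    have h2 := le_stage_cons q C
    constructor
    · rintro (⟨⟨hC, h⟩, rfl⟩ | ⟨⟨hC, h⟩, x, ⟨-, hx⟩, hp, hpx⟩)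
      · refine ⟨⟨?_, by omega⟩, by omega⟩
        rw [List.isChain_cons_cons]
        exact ⟨by omega, hC.1⟩
      · rw [isCluster_nbr_iff_of_eq hC h] at hx
        refine ⟨⟨?_, by omega⟩, by omega⟩
        rw [List.isChain_cons_cons]
        exact ⟨by omega, hC.1⟩
    · rintro ⟨h, h'⟩
      have hc := h.1
      rw [List.isChain_cons_cons] at hc
      have hC : IsCluster k (q :: C) := ⟨hc.2, by omega⟩
      rcases hC.2.lt_or_eq with hl | he
      · left
        exact ⟨⟨hC, hl⟩, by omega⟩
      · right
        exact ⟨⟨hC, he⟩, q + 1, ⟨hC, (isCluster_nbr_iff_of_eq hC he _).2 rfl⟩, by omega, hc.1⟩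

theorem isCluster_succ_iff {k : ℕ} {C : Cluster} :
    IsCluster (k + 1) C ↔ IsCluster k C ∨ (IsCluster (k + 1) C ∧ stage C = k + 1) := by
  unfold IsCluster
  constructor
  · rintro ⟨h1, h2⟩
    rcases h2.lt_or_eq with h | h
    · exact Or.inl ⟨h1, by omega⟩
    · exact Or.inr ⟨⟨h1, h2⟩, h⟩
  · rintro (h | h)
    · exact ⟨h.1, by omega⟩
    · exact h.1

theorem grow_closedSkeleton {k : ℕ} (hk : 1 ≤ k) :
    (closedSkeleton k).grow (k + 1) = closedSkeleton (k + 1) := by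
  simp only [Skeleton.grow, attaches_closedSkeleton hk]
  unfold closedSkeleton
  congr 1
  · ext C
    simp only [Set.mem_union, Set.mem_ofPred_eq]
    rw [isCluster_succ_iff]
    refine or_congr Iff.rfl ⟨?_, ?_⟩
    · rintro ⟨D, p, h, rfl⟩
      exact h
    · rcases C with _ | ⟨p, C⟩
      · rintro ⟨-, h⟩
        simp [stage] at h
      · exact fun h => ⟨C, p, h, rfl⟩
  · ext e
    simp only [Set.mem_union, Set.mem_ofPred_eq]
    constructor
    · rintro (⟨C, p, h, he⟩ | ⟨C, p, h, he⟩)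
      · exact ⟨C, p, isCluster_succ_iff.2 (Or.inl h), he⟩
      · exact ⟨C, p, h.1, he⟩
    · rintro ⟨C, p, h, he⟩
      rcases isCluster_succ_iff.1 h with h | h
      · exact Or.inl ⟨C, p, h, he⟩
      · exact Or.inr ⟨C, p, h, he⟩

theorem isCluster_one_iff {C : Cluster} :
    IsCluster 1 C ↔ C = [] ∨ C = [0] ∨ C = [1] ∨ C = [0, 0] := by
  constructor
  · rintro ⟨h1, h2⟩
    rcases C with _ | ⟨p, _ | ⟨q, _ | ⟨r, C⟩⟩⟩
    · simp
    · simp [stage] at h2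
      interval_cases p <;> simp
    · simp [stage] at h1 h2
      obtain ⟨rfl, h2⟩ := h2
      interval_cases p <;> simp at h1 ⊢
    · simp [stage] at h2
  · rintro (rfl | rfl | rfl | rfl) <;> simp [IsCluster, stage]

theorem ctBase_eq_closedSkeleton : ctBase = closedSkeleton 1 := by
  unfold ctBase closedSkeleton clusterC0 clusterC1 clusterC2 clusterC3
  congr 1
  · ext C
    simp [isCluster_one_iff]
  · ext e
    simp only [Set.mem_insert_iff, Set.mem_singleton_iff, Set.mem_ofPred_eq, isCluster_one_iff]
    constructor
    · rintro (rfl | rfl | rfl)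
      · exact ⟨[], 0, by simp⟩
      · exact ⟨[], 1, by simp⟩
      · exact ⟨[0], 0, by simp⟩
    · rintro ⟨C, p, h, rfl⟩
      simp only [List.cons.injEq, reduceCtorEq, false_or] at h
      rcases h with ⟨rfl, rfl⟩ | ⟨rfl, rfl⟩ | ⟨rfl, rfl⟩ <;> simp

theorem ctSkeleton_eq_closedSkeleton {k : ℕ} (hk : 1 ≤ k) : ctSkeleton k = closedSkeleton k := by
  induction k, hk using Nat.le_induction with
  | base => exact ctBase_eq_closedSkeleton
  | succ k hk ih =>
    obtain ⟨k, rfl⟩ := Nat.exists_eq_add_of_le' hk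
    rw [ctSkeleton, ih, grow_closedSkeleton hk]

/-! ### Matching cluster positions -/

/-- Similarity of clusters at depth `d`: any two clusters of stage at most `d` are similar, and so
are equally labelled children of similar clusters if they have the same stage. -/
inductive SimilarClusters (d : ℕ) : Cluster → Cluster → Prop
  | of_le {C D : Cluster} (hC : stage C ≤ d) (hD : stage D ≤ d) : SimilarClusters d C D
  | cons {C D : Cluster} (p : ℕ) (h : SimilarClusters d C D) (hs : stage (p :: C) = stage (p :: D)) :
      SimilarClusters d (p :: C) (p :: D)

/-- Compatibility at depth `d` of a node in cluster `C`, entered along the edge with outgoing label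
`β ^ a` at `C`, and a node in cluster `D`, entered along the edge with outgoing label `β ^ b` at `D`.
Different entry labels are tolerated only if clusters and labels are small compared with `d`. -/
def Compatible (d : ℕ) (C : Cluster) (a : ℕ) (D : Cluster) (b : ℕ) : Prop :=
  (a = b ∧ SimilarClusters d C D) ∨ (stage C ≤ d ∧ stage D ≤ d ∧ a ≤ d + 1 ∧ b ≤ d + 1)

theorem SimilarClusters.succ {d : ℕ} {C D : Cluster} (h : SimilarClusters d C D) :
    SimilarClusters (d + 1) C D := by
  induction h with
  | of_le hC hD => exact .of_le (by omega) (by omega)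
  | cons p _ hs ih => exact .cons p ih hs

theorem Compatible.similar {d a b : ℕ} {C D : Cluster} (h : Compatible d C a D b) :
    SimilarClusters d C D := by
  rcases h with h | h
  · exact h.2
  · exact .of_le h.1 h.2.1

/-- Before depth `k`, similar clusters of `CT_k` have the same outgoing labels. -/
theorem SimilarClusters.isCluster_nbr_iff {d k : ℕ} {C D : Cluster} (h : SimilarClusters d C D)
    (hd : d < k) (hC : IsCluster k C) (hD : IsCluster k D) (x : ℕ) :
    IsCluster k (nbr C x) ↔ IsCluster k (nbr D x) := by
  cases h with
  | of_le h1 h2 =>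
    rw [isCluster_nbr_iff_of_lt hC (by omega), isCluster_nbr_iff_of_lt hD (by omega)]
  | cons p h hs =>
    rcases hC.2.lt_or_eq with hl | he
    · rw [isCluster_nbr_iff_of_lt hC hl, isCluster_nbr_iff_of_lt hD (by omega)]
    · rw [isCluster_nbr_iff_of_eq hC he, isCluster_nbr_iff_of_eq hD (by omega)]

theorem nbr_eq_cons_of_stage_add_one_lt {C : Cluster} {x : ℕ} (h : stage C + 1 < x) :
    nbr C x = x :: C := by
  rcases C with _ | ⟨p, C⟩
  · rfl
  · have := le_stage_cons p C
    simp only [nbr]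
    rw [if_neg (by omega)]

theorem stage_cons_eq_of_stage_add_one_lt {C : Cluster} {x : ℕ} (h : stage C + 1 < x) :
    stage (x :: C) = x := by
  have h1 := stage_cons_le x C
  have h2 := le_stage_cons x C
  omega

/-- Steps along small labels from clusters of small stage lead to compatible positions, even if the
two labels differ. -/
theorem compatible_nbr_of_le {d x y : ℕ} {C D : Cluster} (hC : stage C ≤ d) (hD : stage D ≤ d)
    (hx : x ≤ d + 1) (hy : y ≤ d + 1) :
    Compatible (d + 1) (nbr C x) (outLabel (nbr C x) C) (nbr D y) (outLabel (nbr D y) D) := by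
  have h1 := stage_nbr_le C x
  have h2 := stage_nbr_le D y
  have h3 := outLabel_nbr_self_le C x
  have h4 := outLabel_nbr_self_le D y
  exact Or.inr ⟨by omega, by omega, by omega, by omega⟩

/-- Steps along the same label from similar clusters lead to compatible positions. -/
theorem SimilarClusters.compatible_nbr {d : ℕ} {C D : Cluster} (h : SimilarClusters d C D) (x : ℕ) :
    Compatible (d + 1) (nbr C x) (outLabel (nbr C x) C) (nbr D x) (outLabel (nbr D x) D) := by
  cases h with
  | of_le h1 h2 =>
    rcases le_or_gt x (d + 1) with hx | hx
    · exact compatible_nbr_of_le h1 h2 hx hx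
    · -- A label beyond `d + 1` leads from both clusters to a child, created at step `x`.
      rw [nbr_eq_cons_of_stage_add_one_lt (show stage C + 1 < x by omega),
        nbr_eq_cons_of_stage_add_one_lt (show stage D + 1 < x by omega)]
      refine Or.inl ⟨by simp [outLabel_cons_self], .cons x (SimilarClusters.of_le h1 h2).succ ?_⟩
      rw [stage_cons_eq_of_stage_add_one_lt (by omega), stage_cons_eq_of_stage_add_one_lt (by omega)]
  | @cons C D p h hs =>
    by_cases hx : x = p + 1
    · subst hx
      simp only [nbr_cons_succ, outLabel_self_cons]
      exact Or.inl ⟨rfl, h.succ⟩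
    · have h1 : ∀ E : Cluster, nbr (p :: E) x = x :: p :: E := fun E => by simp [nbr, hx]
      simp only [h1, outLabel_cons_self]
      exact Or.inl ⟨rfl, .cons x (SimilarClusters.cons p h hs).succ (by simp [stage, hs])⟩

/-- The exceptional step: if a node entered along `a` is matched to one entered along `b`, then
one step along `b` on the one side may be matched to one step along `a` on the other. -/
theorem Compatible.nbr_swap {d a b : ℕ} {C D : Cluster} (h : Compatible d C a D b) :
    Compatible (d + 1) (nbr C b) (outLabel (nbr C b) C) (nbr D a) (outLabel (nbr D a) D) := by
  rcases h with ⟨rfl, h⟩ | ⟨h1, h2, h3, h4⟩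
  · exact h.compatible_nbr a
  · exact compatible_nbr_of_le h1 h2 h4 h3

/-! ### Paths and distances under a girth bound -/

/-- Two different paths with the same ends contain a cycle, so their lengths bound the girth. -/
theorem egirth_le_length_add_length {V : Type*} {G : SimpleGraph V} {u v : V} {p q : G.Walk u v}
    (hp : p.IsPath) (hq : q.IsPath) (hpq : p ≠ q) : G.egirth ≤ (p.length + q.length : ℕ) := by
  classical
  -- The cycle is found in the subgraph formed by the edges of the two paths.
  set s : Set (Sym2 V) := {e | e ∈ p.edges ∨ e ∈ q.edges} with hs
  set H := SimpleGraph.fromEdgeSet s with hH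
  have hsG : s ⊆ G.edgeSet := by
    rintro e (he | he)
    · exact p.edges_subset_edgeSet he
    · exact q.edges_subset_edgeSet he
  have hHs : H.edgeSet = s := by
    rw [hH, SimpleGraph.edgeSet_fromEdgeSet, sdiff_eq_left, Set.disjoint_left]
    intro e he hd
    exact G.not_isDiag_of_mem_edgeSet (hsG he) hd
  have hHG : H ≤ G := by
    rw [← SimpleGraph.edgeSet_subset_edgeSet, hHs]
    exact hsG
  have hpH : ∀ e ∈ p.edges, e ∈ H.edgeSet := fun e he => hHs ▸ Or.inl he
  have hqH : ∀ e ∈ q.edges, e ∈ H.edgeSet := fun e he => hHs ▸ Or.inr he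
  have hcyc : ¬ H.IsAcyclic := by
    intro hac
    have h := (hac.subsingleton_path u v).elim ⟨p.transfer H hpH, hp.transfer hpH⟩
      ⟨q.transfer H hqH, hq.transfer hqH⟩
    have h' : p.transfer H hpH = q.transfer H hqH := congrArg Subtype.val h
    have h2 := congrArg SimpleGraph.Walk.support h'
    rw [SimpleGraph.Walk.support_transfer, SimpleGraph.Walk.support_transfer] at h2
    exact hpq (SimpleGraph.Walk.ext_support h2)
  simp only [SimpleGraph.IsAcyclic, not_forall, not_not] at hcyc
  obtain ⟨a, c, hc⟩ := hcyc
  have hlen : c.length ≤ p.length + q.length := by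
    rw [← c.length_edges, ← p.length_edges, ← q.length_edges, ← List.length_append]
    refine (List.subperm_of_subset hc.edges_nodup fun e he => ?_).length_le
    have := c.edges_subset_edgeSet he
    rw [hHs] at this
    exact List.mem_append.2 this
  calc G.egirth ≤ H.egirth := SimpleGraph.egirth_anti hHG
    _ ≤ c.length := SimpleGraph.egirth_le_length hc
    _ ≤ _ := by exact_mod_cast hlen

/-- The nodes at distance exactly `d` from `v`. -/
def sphere {V : Type*} (G : SimpleGraph V) (v : V) (d : ℕ) : Set V :=
  {w | G.edist v w = d}

section Distance

variable {V : Type*} {G : SimpleGraph V} {v a b w : V} {d e : ℕ}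

theorem eq_of_mem_sphere (ha : a ∈ sphere G v d) (ha' : a ∈ sphere G v e) : d = e := by
  have h : (d : ℕ∞) = e := (Eq.symm ha).trans ha'
  exact_mod_cast h

theorem mem_sphere_zero : a ∈ sphere G v 0 ↔ a = v := by
  simp [sphere, eq_comm (a := a)]

theorem exists_mem_sphere_of_edist_le (h : G.edist v a ≤ d) : ∃ j ≤ d, a ∈ sphere G v j := by
  have hne : G.edist v a ≠ ⊤ := ne_top_of_le_ne_top (ENat.natCast_ne_top d) h
  obtain ⟨j, hj⟩ := ENat.ne_top_iff_exists.1 hne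
  rw [← hj] at h
  exact ⟨j, by exact_mod_cast h, hj.symm⟩

theorem exists_mem_sphere_of_adj (ha : a ∈ sphere G v d) (hab : G.Adj a b) :
    ∃ j ≤ d + 1, b ∈ sphere G v j := by
  apply exists_mem_sphere_of_edist_le
  calc G.edist v b ≤ G.edist v a + G.edist a b := SimpleGraph.edist_triangle
    _ = _ := by rw [SimpleGraph.edist_eq_one_iff_adj.2 hab, show G.edist v a = d from ha]; simp

theorem exists_isPath_of_mem_sphere (ha : a ∈ sphere G v d) :
    ∃ p : G.Walk v a, p.IsPath ∧ p.length = d := by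
  obtain ⟨p, hp⟩ := SimpleGraph.exists_walk_of_edist_eq_coe ha
  refine ⟨p, p.isPath_of_length_eq_dist ?_, hp⟩
  rw [hp, SimpleGraph.dist, show G.edist v a = d from ha]
  simp

/-- A shortest walk to `a` extends to a path by an edge to a node that is not closer to `v`. -/
theorem exists_isPath_concat (ha : a ∈ sphere G v d) (hb : b ∈ sphere G v e) (hde : d ≤ e)
    (hab : G.Adj a b) :
    ∃ p : G.Walk v a, (p.concat hab).IsPath ∧ p.length = d := by
  obtain ⟨p, hp, hl⟩ := exists_isPath_of_mem_sphere ha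
  refine ⟨p, hp.concat ?_ hab, hl⟩
  classical
  intro hmem
  have h1 : (e : ℕ∞) ≤ (p.takeUntil b hmem).length := by
    rw [← show G.edist v b = e from hb]
    exact SimpleGraph.edist_le _
  have h2 : (p.takeUntil b hmem).length < p.length :=
    SimpleGraph.Walk.length_takeUntil_lt_length hmem hab.ne'
  have h3 : e ≤ (p.takeUntil b hmem).length := by exact_mod_cast h1
  omega

theorem exists_adj_mem_sphere_of_mem_sphere_succ (hw : w ∈ sphere G v (d + 1)) :
    ∃ a ∈ sphere G v d, G.Adj a w := by
  obtain ⟨p, hp⟩ := SimpleGraph.exists_walk_of_edist_eq_coe hw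
  have hnil : ¬ p.Nil := by
    intro h
    rw [← SimpleGraph.Walk.length_eq_zero_iff] at h
    omega
  have hadj := p.adj_penultimate hnil
  refine ⟨p.penultimate, ?_, hadj⟩
  have hle : G.edist v p.penultimate ≤ d := by
    refine (SimpleGraph.edist_le p.dropLast).trans ?_
    have h := SimpleGraph.Walk.length_dropLast_add_one hnil
    exact_mod_cast (by omega : p.dropLast.length ≤ d)
  obtain ⟨j, hj, hj'⟩ := exists_mem_sphere_of_edist_le hle
  obtain ⟨i, hi, hi'⟩ := exists_mem_sphere_of_adj hj' hadj
  have := eq_of_mem_sphere hi' hw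
  obtain rfl : j = d := by omega
  exact hj'

/-- Below distance `k`, no edge joins two nodes at the same distance from `v`. -/
theorem not_adj_of_mem_sphere {k : ℕ} (hgirth : ((2 * k + 1 : ℕ) : ℕ∞) ≤ G.egirth) (hd : d < k)
    (ha : a ∈ sphere G v d) (hb : b ∈ sphere G v d) : ¬ G.Adj a b := by
  intro hab
  obtain ⟨p, hp, hpl⟩ := exists_isPath_concat ha hb le_rfl hab
  obtain ⟨q, hq, hql⟩ := exists_isPath_of_mem_sphere hb
  have hne : p.concat hab ≠ q := by
    intro h
    have := congrArg SimpleGraph.Walk.length h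
    rw [SimpleGraph.Walk.length_concat] at this
    omega
  have h := hgirth.trans (egirth_le_length_add_length hp hq hne)
  rw [SimpleGraph.Walk.length_concat, hpl, hql] at h
  have : 2 * k + 1 ≤ d + 1 + d := by exact_mod_cast h
  omega

/-- Within distance `k`, the node through which a shortest walk enters a node is unique. -/
theorem eq_of_adj_of_mem_sphere_succ {k : ℕ} (hgirth : ((2 * k + 1 : ℕ) : ℕ∞) ≤ G.egirth)
    (hd : d < k) (hw : w ∈ sphere G v (d + 1)) (ha : a ∈ sphere G v d) (hb : b ∈ sphere G v d)
    (haw : G.Adj a w) (hbw : G.Adj b w) : a = b := by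
  by_contra hab
  obtain ⟨p, hp, hpl⟩ := exists_isPath_concat ha hw (by omega) haw
  obtain ⟨q, hq, hql⟩ := exists_isPath_concat hb hw (by omega) hbw
  have hne : p.concat haw ≠ q.concat hbw := by
    intro h
    have := congrArg SimpleGraph.Walk.penultimate h
    simp at this
    exact hab this
  have h := hgirth.trans (egirth_le_length_add_length hp hq hne)
  rw [SimpleGraph.Walk.length_concat, SimpleGraph.Walk.length_concat, hpl, hql] at h
  have : 2 * k + 1 ≤ d + 1 + (d + 1) := by exact_mod_cast h
  omega

/-- Below distance `k`, every neighbour of a node other than the parent is one step further away. -/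
theorem mem_sphere_of_adj {k : ℕ} (hgirth : ((2 * k + 1 : ℕ) : ℕ∞) ≤ G.egirth) (hd : d < k)
    (ha : a ∈ sphere G v d) (hab : G.Adj a b) :
    b ∈ sphere G v (d + 1) ∨ ∃ j, d = j + 1 ∧ b ∈ sphere G v j := by
  obtain ⟨j, hj, hb⟩ := exists_mem_sphere_of_adj ha hab
  obtain ⟨i, hi, ha'⟩ := exists_mem_sphere_of_adj hb hab.symm
  have h1 := eq_of_mem_sphere ha ha'
  have h2 : j ≠ d := by
    rintro rfl
    exact not_adj_of_mem_sphere hgirth hd ha hb hab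
  rcases Nat.lt_or_ge d j with h | h
  · obtain rfl : j = d + 1 := by omega
    exact Or.inl hb
  · exact Or.inr ⟨j, by omega, hb⟩

end Distance

/-! ### Matching the nodes of a cluster tree graph -/

/-- Two finite sets whose fibres over each label have equal size are in a label-preserving
bijection. -/
theorem exists_bijOn_of_ncard_fiber_eq {V : Type*} [Finite V] {s t : Set V} (l m : V → ℕ)
    (h : ∀ x, {w | w ∈ s ∧ l w = x}.ncard = {w | w ∈ t ∧ m w = x}.ncard) :
    ∃ g : V → V, Set.BijOn g s t ∧ ∀ w ∈ s, m (g w) = l w := by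
  have key : ∀ x, ∃ g : V → V, Set.BijOn g {w | w ∈ s ∧ l w = x} {w | w ∈ t ∧ m w = x} := by
    intro x
    rcases isEmpty_or_nonempty V with hV | hV
    · exact ⟨id, fun w => (IsEmpty.false w).elim, fun w => (IsEmpty.false w).elim,
        fun w => (IsEmpty.false w).elim⟩
    · refine (Set.toFinite _).exists_bijOn_of_encard_eq ?_
      rw [← (Set.toFinite _).cast_ncard_eq, ← (Set.toFinite _).cast_ncard_eq, h x]
  choose g hg using key
  have hmaps : ∀ w ∈ s, g (l w) w ∈ t ∧ m (g (l w) w) = l w := fun w hw =>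
    (hg (l w)).mapsTo ⟨hw, rfl⟩
  refine ⟨fun w => g (l w) w, ⟨fun w hw => (hmaps w hw).1, ?_, ?_⟩, fun w hw => (hmaps w hw).2⟩
  · intro a ha b hb hab
    have hab' : g (l a) a = g (l b) b := hab
    have hl : l a = l b := by rw [← (hmaps a ha).2, ← (hmaps b hb).2, hab']
    rw [← hl] at hab'
    exact (hg (l a)).injOn ⟨ha, rfl⟩ ⟨hb, hl.symm⟩ hab'
  · intro y hy
    obtain ⟨w, ⟨hw, hl⟩, hwy⟩ := (hg (m y)).surjOn ⟨hy, rfl⟩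
    exact ⟨w, hw, by simpa only [hl] using hwy⟩

section CTGraph

variable {V : Type*} {k β : ℕ} {G : SimpleGraph V} {cl : V → Cluster}

theorem IsCTGraph.isCluster (hG : IsCTGraph k β G cl) (hk : 1 ≤ k) (u : V) :
    IsCluster k (cl u) := by
  have h := hG.mem_clusters u
  rw [ctSkeleton_eq_closedSkeleton hk] at h
  exact h

theorem IsCTGraph.eq_nbr_of_adj (hG : IsCTGraph k β G cl) (hk : 1 ≤ k) {u w : V}
    (h : G.Adj u w) : cl w = nbr (cl u) (outLabel (cl u) (cl w)) := by
  obtain ⟨x, y, hxy⟩ := hG.edge_of_adj u w h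
  rw [ctSkeleton_eq_closedSkeleton hk, mem_edges_closedSkeleton] at hxy
  obtain ⟨-, -, h, -⟩ := hxy
  conv_rhs => rw [h, outLabel_nbr]
  exact h

open Classical in
theorem IsCTGraph.ncard_outLabel_eq (hG : IsCTGraph k β G cl) (hk : 1 ≤ k) (u : V) (x : ℕ) :
    {w | w ∈ G.neighborSet u ∧ outLabel (cl u) (cl w) = x}.ncard =
      if IsCluster k (nbr (cl u) x) then β ^ x else 0 := by
  split_ifs with h
  · have hxy : s((cl u, x), (nbr (cl u) x, outLabel (nbr (cl u) x) (cl u))) ∈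
        (ctSkeleton k).edges := by
      rw [ctSkeleton_eq_closedSkeleton hk, mem_edges_closedSkeleton]
      exact ⟨hG.isCluster hk u, h, rfl, rfl⟩
    rw [← hG.biregular _ _ _ _ hxy u rfl]
    congr 1
    ext w
    refine and_congr_right fun hw => ⟨?_, ?_⟩
    · rintro rfl
      exact hG.eq_nbr_of_adj hk hw
    · intro hw
      rw [hw, outLabel_nbr]
  · convert Set.ncard_empty V
    rw [Set.eq_empty_iff_forall_notMem]
    rintro w ⟨hw, rfl⟩
    rw [← hG.eq_nbr_of_adj hk hw] at h
    exact h (hG.isCluster hk w)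

/-- Before depth `k`, the neighbours of two nodes in similar clusters correspond label by label. -/
theorem IsCTGraph.exists_bijOn_neighborSet [Finite V] (hG : IsCTGraph k β G cl) (hk : 1 ≤ k)
    {d : ℕ} (hd : d < k) {u u' : V} (h : SimilarClusters d (cl u) (cl u')) :
    ∃ g : V → V, Set.BijOn g (G.neighborSet u) (G.neighborSet u') ∧
      ∀ w ∈ G.neighborSet u, outLabel (cl u') (cl (g w)) = outLabel (cl u) (cl w) := by
  classical
  refine exists_bijOn_of_ncard_fiber_eq (fun w => outLabel (cl u) (cl w))
    (fun w => outLabel (cl u') (cl w)) fun x => ?_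
  rw [hG.ncard_outLabel_eq hk, hG.ncard_outLabel_eq hk]
  simp only [h.isCluster_nbr_iff hd (hG.isCluster hk u) (hG.isCluster hk u')]

/-- The children of `u` in the tree of shortest walks from `v`, where `u` is at distance `d`. -/
def children (G : SimpleGraph V) (v : V) (d : ℕ) (u : V) : Set V :=
  G.neighborSet u ∩ sphere G v (d + 1)

/-- Compatibility of two edges `z u` and `z' u'`, traversed towards `u` and `u'`, where `u` and `u'`
are at depth `d`. -/
def CompatibleEdges (cl : V → Cluster) (d : ℕ) (z u z' u' : V) : Prop :=
  Compatible d (cl u) (outLabel (cl u) (cl z)) (cl u') (outLabel (cl u') (cl z'))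

theorem IsCTGraph.compatibleEdges (hG : IsCTGraph k β G cl) (hk : 1 ≤ k) {d : ℕ} {u w u' w' : V}
    (hw : G.Adj u w) (hw' : G.Adj u' w')
    (h : Compatible d (nbr (cl u) (outLabel (cl u) (cl w)))
      (outLabel (nbr (cl u) (outLabel (cl u) (cl w))) (cl u))
      (nbr (cl u') (outLabel (cl u') (cl w')))
      (outLabel (nbr (cl u') (outLabel (cl u') (cl w'))) (cl u'))) :
    CompatibleEdges cl d u w u' w' := by
  rw [← hG.eq_nbr_of_adj hk hw, ← hG.eq_nbr_of_adj hk hw'] at h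
  exact h

theorem IsCTGraph.exists_bijOn_children_root [Finite V] (hG : IsCTGraph k β G cl) (hk : 1 ≤ k)
    {v v' : V} (h : SimilarClusters 0 (cl v) (cl v')) :
    ∃ e : V → V, Set.BijOn e (children G v 0 v) (children G v' 0 v') ∧
      ∀ w ∈ children G v 0 v, CompatibleEdges cl 1 v w v' (e w) := by
  have hch : ∀ v : V, children G v 0 v = G.neighborSet v := by
    intro v
    refine Set.inter_eq_left.2 fun w hw => ?_
    have : G.edist v w = 1 := SimpleGraph.edist_eq_one_iff_adj.2 hw
    simpa [sphere] using this
  obtain ⟨g, hg, hl⟩ := hG.exists_bijOn_neighborSet hk hk h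
  simp only [hch]
  refine ⟨g, hg, fun w hw => hG.compatibleEdges hk hw (hg.mapsTo hw) ?_⟩
  rw [hl w hw]
  exact h.compatible_nbr _

/-- The inductive step of the matching. Neighbours are matched label by label, and the result is
corrected by a transposition so that the parents correspond; the transposition matches one pair of
children with different labels if the entry labels differ. -/
theorem IsCTGraph.exists_bijOn_children [Finite V] (hG : IsCTGraph k β G cl) (hk : 1 ≤ k)
    (hgirth : ((2 * k + 1 : ℕ) : ℕ∞) ≤ G.egirth) {d : ℕ} (hd : d + 1 < k) {v v' z z' u u' : V}
    (hz : z ∈ sphere G v d) (hz' : z' ∈ sphere G v' d)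
    (hu : u ∈ sphere G v (d + 1)) (hu' : u' ∈ sphere G v' (d + 1))
    (hzu : G.Adj z u) (hzu' : G.Adj z' u') (h : CompatibleEdges cl (d + 1) z u z' u') :
    ∃ e : V → V, Set.BijOn e (children G v (d + 1) u) (children G v' (d + 1) u') ∧
      ∀ w ∈ children G v (d + 1) u, CompatibleEdges cl (d + 2) u w u' (e w) := by
  classical
  have hch : ∀ {v z u : V}, z ∈ sphere G v d → u ∈ sphere G v (d + 1) → G.Adj z u →
      children G v (d + 1) u = G.neighborSet u \ {z} := by
    intro v z u hz hu hzu
    ext w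
    refine and_congr_right fun hw => ⟨?_, fun hne => ?_⟩
    · rintro hw' rfl
      have := eq_of_mem_sphere hz hw'
      omega
    · rcases mem_sphere_of_adj hgirth hd hu hw with h | ⟨j, hj, h⟩
      · exact h
      · obtain rfl : d = j := by omega
        exact absurd (eq_of_adj_of_mem_sphere_succ hgirth (by omega) hu h hz hw.symm hzu) hne
  obtain ⟨g, hg, hl⟩ := hG.exists_bijOn_neighborSet hk hd h.similar
  have hgz : g z ∈ G.neighborSet u' := hg.mapsTo hzu.symm
  have hbij : Set.BijOn (Equiv.swap (g z) z' ∘ g) (G.neighborSet u) (G.neighborSet u') :=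
    (Equiv.swap_bijOn_self (iff_of_true hgz hzu'.symm)).comp hg
  refine ⟨Equiv.swap (g z) z' ∘ g, ?_, ?_⟩
  · rw [hch hz hu hzu, hch hz' hu' hzu']
    have := hbij.sdiff_singleton (show z ∈ G.neighborSet u from hzu.symm)
    simpa using this
  · intro w hw
    have hwu : G.Adj u w := hw.1
    have hwz : w ≠ z := by
      rw [hch hz hu hzu] at hw
      exact hw.2
    refine hG.compatibleEdges hk hwu (hbij.mapsTo hwu) ?_
    have hgw : g w ≠ g z := fun h => hwz (hg.injOn hwu hzu.symm h)
    rw [Function.comp_apply]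
    by_cases hw' : g w = z'
    · rw [hw', Equiv.swap_apply_right, hl z hzu.symm, ← hl w hwu, hw']
      exact h.nbr_swap
    · rw [Equiv.swap_apply_of_ne_of_ne hgw hw', hl w hwu]
      exact h.similar.compatible_nbr _

/-- `f` matches the nodes within distance `d` of `v` with those within distance `d` of `v'`: it
respects distances and the tree edges, and matched tree edges are compatible. -/
structure IsTreeMatching (G : SimpleGraph V) (cl : V → Cluster) (v v' : V) (d : ℕ) (f : V → V) :
    Prop where
  bijOn : ∀ j ≤ d, Set.BijOn f (sphere G v j) (sphere G v' j)
  adj_iff : ∀ j < d, ∀ a ∈ sphere G v j, ∀ b ∈ sphere G v (j + 1), G.Adj a b ↔ G.Adj (f a) (f b)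
  compatible : ∀ j < d, ∀ a ∈ sphere G v j, ∀ b ∈ sphere G v (j + 1), G.Adj a b →
    CompatibleEdges cl (j + 1) a b (f a) (f b)

/-- At depth `0` only the centres are matched, so every value of `f` away from `v` is irrelevant. -/
theorem isTreeMatching_zero (v v' : V) : IsTreeMatching G cl v v' 0 fun _ => v' where
  bijOn j hj := by
    obtain rfl : j = 0 := by omega
    refine ⟨fun a _ => mem_sphere_zero.2 rfl, fun a ha b hb _ => ?_, fun y hy => ?_⟩
    · rw [mem_sphere_zero.1 ha, mem_sphere_zero.1 hb]
    · exact ⟨v, mem_sphere_zero.2 rfl, (mem_sphere_zero.1 hy).symm⟩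
  adj_iff j hj := absurd hj (by omega)
  compatible j hj := absurd hj (by omega)

/-- The bijections between the children of matched nodes. -/
theorem IsTreeMatching.exists_bijOn_children [Finite V] (hG : IsCTGraph k β G cl) (hk : 1 ≤ k)
    (hgirth : ((2 * k + 1 : ℕ) : ℕ∞) ≤ G.egirth) {d : ℕ} (hd : d < k) {v v' : V} {f : V → V}
    (hv : SimilarClusters 0 (cl v) (cl v')) (hf : IsTreeMatching G cl v v' d f) {u : V}
    (hu : u ∈ sphere G v d) :
    ∃ e : V → V, Set.BijOn e (children G v d u) (children G v' d (f u)) ∧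
      ∀ w ∈ children G v d u, CompatibleEdges cl (d + 1) u w (f u) (e w) := by
  have hfu := (hf.bijOn d le_rfl).mapsTo hu
  rcases d with _ | d
  · rw [mem_sphere_zero] at hu hfu
    rw [hfu, hu]
    exact hG.exists_bijOn_children_root hk hv
  · obtain ⟨z, hz, hzu⟩ := exists_adj_mem_sphere_of_mem_sphere_succ hu
    exact hG.exists_bijOn_children hk hgirth hd hz ((hf.bijOn d (by omega)).mapsTo hz) hu hfu hzu
      ((hf.adj_iff d (by omega) z hz u hu).1 hzu) (hf.compatible d (by omega) z hz u hu hzu)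

/-- A tree matching extends by one level: every node at distance `d + 1` is mapped by the bijection
between the children of its unique parent and those of the image of the parent. -/
theorem IsTreeMatching.exists_succ [Finite V] (hG : IsCTGraph k β G cl) (hk : 1 ≤ k)
    (hgirth : ((2 * k + 1 : ℕ) : ℕ∞) ≤ G.egirth) {d : ℕ} (hd : d < k) {v v' : V} {f : V → V}
    (hv : SimilarClusters 0 (cl v) (cl v')) (hf : IsTreeMatching G cl v v' d f) :
    ∃ f', IsTreeMatching G cl v v' (d + 1) f' := by
  classical
  choose! e he hc using fun u (hu : u ∈ sphere G v d) =>
    hf.exists_bijOn_children hG hk hgirth hd hv hu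
  choose! par hpar hadj using fun w (hw : w ∈ sphere G v (d + 1)) =>
    exists_adj_mem_sphere_of_mem_sphere_succ hw
  have hpar_eq : ∀ {a b}, a ∈ sphere G v d → b ∈ sphere G v (d + 1) → G.Adj a b → a = par b :=
    fun ha hb hab => eq_of_adj_of_mem_sphere_succ hgirth hd hb ha (hpar _ hb) hab (hadj _ hb)
  have hfS := hf.bijOn d le_rfl
  have hmaps : ∀ w ∈ sphere G v (d + 1), e (par w) w ∈ children G v' d (f (par w)) := fun w hw =>
    (he _ (hpar w hw)).mapsTo ⟨hadj w hw, hw⟩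
  -- The parents of matched nodes are matched.
  have hparent : ∀ a ∈ sphere G v d, ∀ b ∈ sphere G v (d + 1), G.Adj (f a) (e (par b) b) →
      a = par b := by
    intro a ha b hb hab
    have h1 := hmaps b hb
    refine hfS.injOn ha (hpar b hb) ?_
    exact eq_of_adj_of_mem_sphere_succ hgirth hd h1.2 (hfS.mapsTo ha)
      (hfS.mapsTo (hpar b hb)) hab h1.1
  set f' : V → V := fun w => if w ∈ sphere G v (d + 1) then e (par w) w else f w with hf'
  have hnew : ∀ w ∈ sphere G v (d + 1), f' w = e (par w) w := fun w hw => if_pos hw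
  have hold : ∀ j ≤ d, ∀ w ∈ sphere G v j, f' w = f w := by
    intro j hj w hw
    refine if_neg fun h => ?_
    have := eq_of_mem_sphere hw h
    omega
  refine ⟨f', ⟨?_, ?_, ?_⟩⟩
  · intro j hj
    rcases Nat.lt_or_ge d j with hlt | hle
    · obtain rfl : j = d + 1 := by omega
      refine ⟨fun w hw => ?_, fun a ha b hb hab => ?_, fun y hy => ?_⟩
      · rw [hnew w hw]
        exact (hmaps w hw).2
      · rw [hnew a ha, hnew b hb] at hab
        have h1 := (hmaps a ha).1
        rw [hab] at h1
        have h2 := hparent _ (hpar a ha) b hb h1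
        rw [← h2] at hab
        exact (he _ (hpar a ha)).injOn ⟨hadj a ha, ha⟩ ⟨h2 ▸ hadj b hb, hb⟩ hab
      · obtain ⟨z', hz', hzy⟩ := exists_adj_mem_sphere_of_mem_sphere_succ hy
        obtain ⟨z, hz, rfl⟩ := hfS.surjOn hz'
        obtain ⟨w, hw, rfl⟩ := (he z hz).surjOn ⟨hzy, hy⟩
        refine ⟨w, hw.2, ?_⟩
        rw [hnew w hw.2, ← hpar_eq hz hw.2 hw.1]
    · exact (hf.bijOn j hle).congr fun w hw => (hold j hle w hw).symm
  · intro j hj a ha b hb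
    rw [hold j (by omega) a ha]
    rcases Nat.lt_or_ge j d with hlt | hge
    · rw [hold (j + 1) (by omega) b hb]
      exact hf.adj_iff j hlt a ha b hb
    · obtain rfl : j = d := by omega
      rw [hnew b hb]
      constructor
      · intro hab
        rw [hpar_eq ha hb hab]
        exact (hmaps b hb).1
      · intro hab
        rw [hparent a ha b hb hab]
        exact hadj b hb
  · intro j hj a ha b hb hab
    rw [hold j (by omega) a ha]
    rcases Nat.lt_or_ge j d with hlt | hge
    · rw [hold (j + 1) (by omega) b hb]
      exact hf.compatible j hlt a ha b hb hab
    · obtain rfl : j = d := by omega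
      rw [hnew b hb, ← hpar_eq ha hb hab]
      exact hc a ha b ⟨hab, hb⟩

theorem exists_isTreeMatching [Finite V] (hG : IsCTGraph k β G cl) (hk : 1 ≤ k)
    (hgirth : ((2 * k + 1 : ℕ) : ℕ∞) ≤ G.egirth) {v v' : V}
    (hv : SimilarClusters 0 (cl v) (cl v')) {d : ℕ} (hd : d ≤ k) :
    ∃ f, IsTreeMatching G cl v v' d f := by
  induction d with
  | zero => exact ⟨_, isTreeMatching_zero v v'⟩
  | succ d ih =>
    obtain ⟨f, hf⟩ := ih (by omega)
    exact hf.exists_succ hG hk hgirth (by omega) hv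

theorem mem_verts_kHopSubgraph {v a : V} :
    a ∈ (kHopSubgraph G k v).verts ↔ ∃ j ≤ k, a ∈ sphere G v j := by
  refine ⟨fun h => exists_mem_sphere_of_edist_le h, ?_⟩
  rintro ⟨j, hj, ha⟩
  change G.edist v a ≤ k
  rw [show G.edist v a = j from ha]
  exact_mod_cast hj

/-- Under the girth bound, the edges of a `k`-hop subgraph are those of a tree: they join nodes at
consecutive distances from the centre. -/
theorem kHopSubgraph_adj_iff (hgirth : ((2 * k + 1 : ℕ) : ℕ∞) ≤ G.egirth) {v a b : V} :
    (kHopSubgraph G k v).Adj a b ↔ ∃ j < k, G.Adj a b ∧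
      ((a ∈ sphere G v j ∧ b ∈ sphere G v (j + 1)) ∨
        (b ∈ sphere G v j ∧ a ∈ sphere G v (j + 1))) := by
  constructor
  · rintro ⟨hab, ha, hb, hne⟩
    obtain ⟨i, hi, hai⟩ := mem_verts_kHopSubgraph.1 ha
    obtain ⟨j, hj, hbj⟩ := mem_verts_kHopSubgraph.1 hb
    rcases hi.lt_or_eq with hik | rfl
    · rcases mem_sphere_of_adj hgirth hik hai hab with h | ⟨l, hl, h⟩
      · exact ⟨i, hik, hab, Or.inl ⟨hai, h⟩⟩
      · exact ⟨l, by omega, hab, Or.inr ⟨h, hl ▸ hai⟩⟩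
    · have hjk : j < i := by
        refine lt_of_le_of_ne hj ?_
        rintro rfl
        exact hne ⟨hai, hbj⟩
      rcases mem_sphere_of_adj hgirth hjk hbj hab.symm with h | ⟨l, hl, h⟩
      · exact ⟨j, hjk, hab, Or.inr ⟨hbj, h⟩⟩
      · have := eq_of_mem_sphere hai h
        omega
  · have key : ∀ {a b : V} {j : ℕ}, j < k → G.Adj a b → a ∈ sphere G v j →
        b ∈ sphere G v (j + 1) → (kHopSubgraph G k v).Adj a b := by
      intro a b j hj hab ha hb
      refine ⟨hab, mem_verts_kHopSubgraph.2 ⟨j, hj.le, ha⟩,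
        mem_verts_kHopSubgraph.2 ⟨j + 1, hj, hb⟩, fun h => ?_⟩
      have := eq_of_mem_sphere ha h.1
      omega
    rintro ⟨j, hj, hab, ⟨ha, hb⟩ | ⟨hb, ha⟩⟩
    · exact key hj hab ha hb
    · exact (key hj hab.symm hb ha).symm

theorem IsTreeMatching.kHopIndistinguishable (hgirth : ((2 * k + 1 : ℕ) : ℕ∞) ≤ G.egirth)
    {v v' : V} {f : V → V} (hf : IsTreeMatching G cl v v' k f) :
    KHopIndistinguishable G k v v' := by
  have hfv : f v = v' :=
    mem_sphere_zero.1 ((hf.bijOn 0 (Nat.zero_le k)).mapsTo (mem_sphere_zero.2 rfl))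
  have hmem : ∀ {a i}, a ∈ (kHopSubgraph G k v).verts → i ≤ k →
      (f a ∈ sphere G v' i ↔ a ∈ sphere G v i) := by
    intro a i ha hi
    refine ⟨fun hfa => ?_, fun h => (hf.bijOn i hi).mapsTo h⟩
    obtain ⟨l, hl, ha⟩ := mem_verts_kHopSubgraph.1 ha
    obtain rfl := eq_of_mem_sphere ((hf.bijOn l hl).mapsTo ha) hfa
    exact ha
  have hbij : Set.BijOn f (kHopSubgraph G k v).verts (kHopSubgraph G k v').verts := by
    refine ⟨fun a ha => ?_, fun a ha b hb hab => ?_, fun y hy => ?_⟩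
    · obtain ⟨j, hj, ha⟩ := mem_verts_kHopSubgraph.1 ha
      exact mem_verts_kHopSubgraph.2 ⟨j, hj, (hf.bijOn j hj).mapsTo ha⟩
    · obtain ⟨j, hj, ha'⟩ := mem_verts_kHopSubgraph.1 ha
      have h := (hf.bijOn j hj).mapsTo ha'
      rw [hab] at h
      exact (hf.bijOn j hj).injOn ha' ((hmem hb hj).1 h) hab
    · obtain ⟨j, hj, hy⟩ := mem_verts_kHopSubgraph.1 hy
      obtain ⟨a, ha, rfl⟩ := (hf.bijOn j hj).surjOn hy
      exact ⟨a, mem_verts_kHopSubgraph.2 ⟨j, hj, ha⟩, rfl⟩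
  refine ⟨⟨hbij.equiv f, ?_⟩, Subtype.ext hfv⟩
  rintro ⟨a, ha⟩ ⟨b, hb⟩
  change (kHopSubgraph G k v').Adj (f a) (f b) ↔ (kHopSubgraph G k v).Adj a b
  rw [kHopSubgraph_adj_iff hgirth, kHopSubgraph_adj_iff hgirth]
  refine exists_congr fun j => and_congr_right fun hj => ?_
  rw [hmem ha hj.le, hmem hb hj.le, hmem ha hj, hmem hb hj]
  constructor
  · rintro ⟨hab, ⟨h1, h2⟩ | ⟨h1, h2⟩⟩
    · exact ⟨(hf.adj_iff j hj a h1 b h2).2 hab, Or.inl ⟨h1, h2⟩⟩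
    · exact ⟨((hf.adj_iff j hj b h1 a h2).2 hab.symm).symm, Or.inr ⟨h1, h2⟩⟩
  · rintro ⟨hab, ⟨h1, h2⟩ | ⟨h1, h2⟩⟩
    · exact ⟨(hf.adj_iff j hj a h1 b h2).1 hab, Or.inl ⟨h1, h2⟩⟩
    · exact ⟨((hf.adj_iff j hj b h1 a h2).1 hab.symm).symm, Or.inr ⟨h1, h2⟩⟩

end CTGraph

theorem mainTheorem1 {V : Type*} [Finite V] (k β : ℕ) (hk : 1 ≤ k) (hβ : 2 * (k + 1) ≤ β)
    (G : SimpleGraph V) (cl : V → Cluster) (hG : IsCTGraph k β G cl)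
    (hgirth : ((2 * k + 1 : ℕ) : ℕ∞) ≤ G.egirth)
    (v₀ v₁ : V) (hv₀ : cl v₀ = clusterC0) (hv₁ : cl v₁ = clusterC1) :
    KHopIndistinguishable G k v₀ v₁ := by
  have hv : SimilarClusters 0 (cl v₀) (cl v₁) := by
    rw [hv₀, hv₁]
    exact .of_le le_rfl le_rfl
  obtain ⟨f, hf⟩ := exists_isTreeMatching hG hk hgirth hv le_rfl
  exact hf.kHopIndistinguishable hgirth
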